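/- Consider a network game with $N$ players. Let $G\in\mathbb R^{N\times N}$ be a matrix with $G_{ij}\ge 0$ and $G_{ii}=0$. Player $i$ chooses $x^i$ in a nonempty, closed, convex set $\mathcal X^i\subseteq\mathbb R^n$ to minimize the cost $J^i(x^i,z^i(x))$, where $z^i(x)=\sum_{j=1}^N G_{ij}x^j$. Put $\mathcal X=\mathcal X^1\times\dots\times\mathcal X^N$ and $\mathcal Z^i=\{z^i(x):x\in\mathcal X\}$. A point $x^\star\in\mathcal X$ is a Nash equilibrium if $x^{\star i}\in B^i(z^i(x^\star))$ for all $i$, where $B^i(z)=\arg\min_{y\in\mathcal X^i}J^i(y,z)$. Suppose that the costs have the form $$J^i(x^i,z^i)=\tfrac12 (x^i)^\top Q^i x^i+f^i(z^i)^\top x^i$$ with $Q^i=(Q^i)^\top\succ 0$ and $f^i:\mathbb R^n\to\mathbb R^n$, that $J^i(\cdot,z)$ is continuously differentiable on $\mathbb R^n$ and convex on $\mathcal X^i$ for every $z\in\mathcal Z^i$, that $J^i$ is twice differentiable in $[x^i;z^i]$ at every point of $\mathcal X^i\times\mathcal Z^i$, and that $\nabla_{x^i}J^i$ is Lipschitz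 in $[x^i;z^i]$ on $\mathcal X^i\times\mathcal Z^i$. Suppose that the game Jacobian $F(x)=[\nabla_{x^i}J^i(x^i,z^i(x))]_{i=1}^N$ is strongly monotone on $\mathcal X$, i.e. there is $\alpha>0$ with $(F(x)-F(y))^\top(x-y)\ge\alpha\|x-y\|_2^2$ for all $x,y\in\mathcal X$. Then the game has a unique Nash equilibrium $x^\star$, and for every $x_0\in\mathcal X$ the continuous best-response dynamics $$\dot x^i(t)=B^i(z^i(x(t)))-x^i(t),\quad i=1,\dots,N,\qquad x(0)=x_0,$$ have a unique solution $x(t)$ on $[0,\infty)$, and $x(t)\to x^\star$ as $t\to\infty$. -/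

import Mathlib

open scoped NNReal Topology

/-- Strategy profiles `x = [x¹; …; x^N]` of `N` players with strategies in `ℝⁿ`, carrying the
Euclidean norm and inner product of `ℝ^{Nn}`. -/
abbrev Profile (N n : ℕ) : Type :=
  PiLp 2 (fun _ : Fin N => EuclideanSpace ℝ (Fin n))

/-- A network game with `N` players: a non-negative weighted adjacency matrix with zero diagonal,
feasible sets `Xⁱ ⊆ ℝⁿ`, and cost functions `Jⁱ(xⁱ, zⁱ)` of the own strategy `xⁱ` and of the
neighbour aggregate `zⁱ`. -/
structure NetworkGame (N n : ℕ) where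
  adj : Matrix (Fin N) (Fin N) ℝ
  adj_nonneg : ∀ i j, 0 ≤ adj i j
  adj_diag : ∀ i, adj i i = 0
  feasible : Fin N → Set (EuclideanSpace ℝ (Fin n))
  cost : Fin N → EuclideanSpace ℝ (Fin n) → EuclideanSpace ℝ (Fin n) → ℝ

namespace NetworkGame

variable {N n : ℕ}

/-- The product `X = X¹ × … × X^N`. -/
def profiles (g : NetworkGame N n) : Set (Profile N n) :=
  {x | ∀ i, x i ∈ g.feasible i}

/-- The neighbour aggregate `zⁱ(x) = ∑ⱼ Gᵢⱼ xʲ`. -/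
def aggregate (g : NetworkGame N n) (i : Fin N) (x : Profile N n) : EuclideanSpace ℝ (Fin n) :=
  ∑ j, g.adj i j • x j

/-- The set of values that the aggregate `zⁱ(x)` takes on feasible profiles. -/
def aggregates (g : NetworkGame N n) (i : Fin N) : Set (EuclideanSpace ℝ (Fin n)) :=
  g.aggregate i '' g.profiles

/-- The best responses `Bⁱ(z)`: the set of minimizers of `Jⁱ(·, z)` over `Xⁱ`. -/
def bestResponse (g : NetworkGame N n) (i : Fin N) (z : EuclideanSpace ℝ (Fin n)) :
    Set (EuclideanSpace ℝ (Fin n)) :=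
  {y | y ∈ g.feasible i ∧ ∀ w ∈ g.feasible i, g.cost i y z ≤ g.cost i w z}

/-- `x` is a Nash equilibrium: every player plays a best response to the others' strategies. -/
def IsNash (g : NetworkGame N n) (x : Profile N n) : Prop :=
  ∀ i, x i ∈ g.bestResponse i (g.aggregate i x)

/-- The partial gradient of `Jⁱ(y, z)` with respect to the own strategy `y`. -/
noncomputable def ownGradient (g : NetworkGame N n) (i : Fin N)
    (y z : EuclideanSpace ℝ (Fin n)) : EuclideanSpace ℝ (Fin n) :=
  gradient (fun w => g.cost i w z) y

/-- The game Jacobian `F(x) = [∇_{xⁱ} Jⁱ(xⁱ, zⁱ(x))]ᵢ`. -/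
noncomputable def gameJacobian (g : NetworkGame N n) (x : Profile N n) : Profile N n :=
  WithLp.toLp 2 (fun i => g.ownGradient i (x i) (g.aggregate i x))

/-- The standing regularity assumption on a network game. The conditions in `[xⁱ; zⁱ]` are imposed
on the feasible strategies and the aggregates that can arise from feasible profiles. -/
structure IsRegular (g : NetworkGame N n) : Prop where
  nonempty : ∀ i, (g.feasible i).Nonempty
  isClosed : ∀ i, IsClosed (g.feasible i)
  convex : ∀ i, Convex ℝ (g.feasible i)
  /-- `Jⁱ` is continuously differentiable in `xⁱ`. -/
  contDiff_cost : ∀ i, ∀ z ∈ g.aggregates i, ContDiff ℝ 1 (fun y => g.cost i y z)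
  /-- `Jⁱ` is convex in `xⁱ`. -/
  convexOn_cost : ∀ i, ∀ z ∈ g.aggregates i, ConvexOn ℝ (g.feasible i) (fun y => g.cost i y z)
  /-- `Jⁱ` is twice differentiable in `[xⁱ; zⁱ]`: differentiable around the point, with a
  derivative that is differentiable at the point. -/
  twice_differentiable : ∀ i, ∀ y ∈ g.feasible i, ∀ z ∈ g.aggregates i,
    (∀ᶠ p in 𝓝 (y, z), DifferentiableAt ℝ (fun q => g.cost i q.1 q.2) p) ∧
      DifferentiableAt ℝ (fderiv ℝ (fun q => g.cost i q.1 q.2)) (y, z)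
  /-- `∇_{xⁱ} Jⁱ` is Lipschitz in `[xⁱ; zⁱ]`. -/
  lipschitz_gradient : ∀ i, ∃ K : ℝ≥0,
    LipschitzOnWith K (fun q => g.ownGradient i q.1 q.2) (g.feasible i ×ˢ g.aggregates i)

/-- `x(t)`, `t ≥ 0`, is a trajectory of the continuous best-response dynamics
`ẋⁱ(t) = Bⁱ(zⁱ(x(t))) - xⁱ(t)`, `x(0) = x₀` (the derivative at `t = 0` is one-sided). -/
def IsBRTrajectory (g : NetworkGame N n) (x₀ : Profile N n) (x : ℝ → Profile N n) : Prop :=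
  x 0 = x₀ ∧ ∀ t : ℝ, 0 ≤ t → ∀ i, ∃ b ∈ g.bestResponse i (g.aggregate i (x t)),
    HasDerivWithinAt (fun s => x s i) (b - x t i) (Set.Ici 0) t

end NetworkGame

/-- `F` is strongly monotone on `X`: for some `α > 0`,
`(F(x) - F(y))ᵀ(x - y) ≥ α ‖x - y‖²` for all `x, y ∈ X`. -/
def StronglyMonotoneOn {E : Type*} [NormedAddCommGroup E] [InnerProductSpace ℝ E]
    (F : E → E) (X : Set E) : Prop :=
  ∃ α : ℝ, 0 < α ∧ ∀ x ∈ X, ∀ y ∈ X, α * ‖x - y‖ ^ 2 ≤ inner ℝ (F x - F y) (x - y)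

/-- The weighted square norm `‖x‖²_Q = xᵀ Q x`. -/
def weightedNormSq {n : ℕ} (Q : Matrix (Fin n) (Fin n) ℝ) (x : EuclideanSpace ℝ (Fin n)) : ℝ :=
  x.ofLp ⬝ᵥ (Q.mulVec x.ofLp)

/-! For quadratic costs the block `Qⁱ xⁱ + fⁱ(zⁱ)` of `F(x)` and the gradient at the best response
differ exactly by `Qⁱ(Bⁱ - xⁱ)`. With `A = diag(Qⁱ)`, the joint best response `H x` is therefore the
projection of `x - A⁻¹ F(x)` to `X` in the `A`-norm, and the dynamics are a projection flow `ẋ =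
H(x) - x` for the variational inequality of `F` (`isForwardProjection_of_mem_bestResponse`).

Fukushima's regularized gap is a Lyapunov function for this flow: strong monotonicity makes it decay
at rate at least `α ‖H x - x‖²` (`eventually_slope_regularizedGap_lt`). It dominates a multiple of
`‖H x - x‖²` and, along a trajectory, is at most a multiple of `‖H x - x‖`, so both tend to zero.
The error bound `‖x - y‖ ≤ C ‖(H x - x) - (H y - y)‖` (`norm_sub_le`) then makes the trajectory
Cauchy, and its limit is a fixed point of `H`, that is, an equilibrium. The same bound gives
uniqueness. -/

/-! ### Global solutions, invariance and uniqueness for `ẋ = H(x) - x` on a closed convex set. -/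

section ODE

open Set Filter MeasureTheory

variable {E : Type*} [NormedAddCommGroup E]

/-- An autonomous differential equation with a globally Lipschitz right-hand side has a solution on
`[0, ∞)` for every initial value. -/
theorem LipschitzWith.exists_hasDerivWithinAt_Ici [NormedSpace ℝ E] [CompleteSpace E] {v : E → E}
    {L : ℝ≥0} (hv : LipschitzWith L v) (x₀ : E) :
    ∃ x : ℝ → E, x 0 = x₀ ∧ ∀ t, 0 ≤ t → HasDerivWithinAt x (v (x t)) (Ici 0) t := by
  set l : ℝ := L + 1 with hl
  have hl0 : 0 < l := by positivity
  -- Functions of growth `exp (l s)` are encoded by bounded functions `w`. In this weighted sup norm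
  -- the Picard operator contracts with factor `L / l < 1` on all of `[0, ∞)` at once.
  let u : BoundedContinuousFunction ℝ E → ℝ → E := fun w s => x₀ + Real.exp (l * s) • w s
  have hu : ∀ w, Continuous (fun s => v (u w s)) := fun w =>
    hv.continuous.comp (continuous_const.add
      ((Real.continuous_exp.comp (continuous_const.mul continuous_id)).smul w.continuous))
  let I : BoundedContinuousFunction ℝ E → ℝ → E := fun w t => ∫ s in (0 : ℝ)..t, v (u w s)
  have hI : ∀ w t, HasDerivAt (I w) (v (u w t)) t := fun w t =>
    intervalIntegral.integral_hasDerivAt_right ((hu w).intervalIntegrable _ _)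
      ((hu w).stronglyMeasurableAtFilter _ _) (hu w).continuousAt
  have key : ∀ (h : ℝ → E) (M : ℝ), 0 ≤ M → (∀ s, 0 ≤ s → ‖h s‖ ≤ M * Real.exp (l * s)) →
      ∀ t, 0 ≤ t → ‖Real.exp (-(l * t)) • ∫ s in (0 : ℝ)..t, h s‖ ≤ M / l := by
    intro h M hM hh t ht
    have h1 : ‖∫ s in (0 : ℝ)..t, h s‖ ≤ ∫ s in (0 : ℝ)..t, M * Real.exp (l * s) := by
      apply intervalIntegral.norm_integral_le_of_norm_le ht
      · exact Eventually.of_forall fun s hs => hh s hs.1.le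
      · exact Continuous.intervalIntegrable (by fun_prop) _ _
    have h2 : ∫ s in (0 : ℝ)..t, M * Real.exp (l * s) = M / l * (Real.exp (l * t) - 1) := by
      rw [intervalIntegral.integral_eq_sub_of_hasDerivAt
        (f := fun s => M / l * Real.exp (l * s))]
      · simp; ring
      · intro s _
        have := (((hasDerivAt_id s).const_mul l).exp).const_mul (M / l)
        exact this.congr_deriv (by simp; field_simp)
      · exact Continuous.intervalIntegrable (by fun_prop) _ _
    rw [norm_smul, Real.norm_eq_abs, abs_of_pos (Real.exp_pos _)]
    rw [h2] at h1
    calc Real.exp (-(l * t)) * ‖∫ s in (0 : ℝ)..t, h s‖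
        ≤ Real.exp (-(l * t)) * (M / l * Real.exp (l * t)) := by
          gcongr
          refine h1.trans ?_
          have : 0 ≤ M / l := by positivity
          nlinarith
      _ = M / l := by
          rw [mul_left_comm, ← Real.exp_add]; simp
  have bound : ∀ w s, 0 ≤ s → ‖v (u w s)‖ ≤ (‖v x₀‖ + L * ‖w‖) * Real.exp (l * s) := by
    intro w s hs
    have h1 : ‖v (u w s) - v x₀‖ ≤ L * (Real.exp (l * s) * ‖w‖) := by
      refine (hv.norm_sub_le _ _).trans ?_
      simp only [u, add_sub_cancel_left, norm_smul, Real.norm_eq_abs, abs_of_pos (Real.exp_pos _)]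
      gcongr
      exact w.norm_coe_le_norm s
    have h2 : 1 ≤ Real.exp (l * s) := Real.one_le_exp (by positivity)
    have h3 := norm_le_norm_add_norm_sub' (v (u w s)) (v x₀)
    nlinarith [norm_nonneg (v x₀)]
  -- `max t 0` freezes the function at negative times, where the weight gives no bound.
  let Φ : BoundedContinuousFunction ℝ E → BoundedContinuousFunction ℝ E := fun w =>
    BoundedContinuousFunction.ofNormedAddCommGroup
      (fun t => Real.exp (-(l * max t 0)) • I w (max t 0))
      (by
        have : Continuous (I w) := continuous_iff_continuousAt.2 fun t => (hI w t).continuousAt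
        fun_prop)
      ((‖v x₀‖ + L * ‖w‖) / l)
      (fun t => key _ _ (by positivity) (bound w) _ (le_max_right _ _))
  have hΦ : ContractingWith (L / (L + 1)) Φ := by
    refine ⟨by rw [div_lt_one (by positivity)]; exact lt_add_one L, ?_⟩
    refine LipschitzWith.of_dist_le_mul fun w w' => ?_
    rw [BoundedContinuousFunction.dist_le (by positivity)]
    intro t
    have h0 : (0 : ℝ) ≤ max t 0 := le_max_right _ _
    have h1 := key (fun s => v (u w s) - v (u w' s)) (L * dist w w') (by positivity) (by
      intro s hs
      refine (hv.norm_sub_le _ _).trans ?_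
      simp only [u, add_sub_add_left_eq_sub, ← smul_sub, norm_smul, Real.norm_eq_abs,
        abs_of_pos (Real.exp_pos _)]
      rw [mul_assoc, mul_comm (dist w w')]
      gcongr
      rw [← dist_eq_norm]
      exact BoundedContinuousFunction.dist_coe_le_dist s) _ h0
    rw [intervalIntegral.integral_sub ((hu w).intervalIntegrable _ _)
      ((hu w').intervalIntegrable _ _), smul_sub] at h1
    rw [dist_eq_norm]
    refine h1.trans (le_of_eq ?_)
    rw [hl]; push_cast; ring
  obtain ⟨w, hw⟩ : ∃ w, Φ w = w := ⟨_, hΦ.fixedPoint_isFixedPt⟩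
  have hwt : ∀ t, 0 ≤ t → x₀ + I w t = u w t := by
    intro t ht
    have : w t = Real.exp (-(l * t)) • I w t := by
      conv_lhs => rw [← hw]
      simp [Φ, max_eq_left ht]
    simp only [u]
    rw [this, smul_smul, ← Real.exp_add]; simp
  refine ⟨fun t => x₀ + I w t, by simp [I], fun t ht => ?_⟩
  simp only
  rw [hwt t ht]
  exact ((hI w t).const_add x₀).hasDerivWithinAt

variable [InnerProductSpace ℝ E]

/-- A nonempty closed convex set of a Hilbert space is a `1`-Lipschitz retract. -/
theorem Convex.exists_lipschitzWith_one_retraction [CompleteSpace E] {K : Set E} (hne : K.Nonempty)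
    (hcl : IsClosed K) (hK : Convex ℝ K) :
    ∃ P : E → E, LipschitzWith 1 P ∧ (∀ x, P x ∈ K) ∧ ∀ x ∈ K, P x = x := by
  have h : ∀ u : E, ∃ p ∈ K, ∀ w ∈ K, inner ℝ (u - p) (w - p) ≤ 0 := by
    intro u
    obtain ⟨p, hp, h⟩ := exists_norm_eq_iInf_of_complete_convex hne hcl.isComplete hK u
    exact ⟨p, hp, (norm_eq_iInf_iff_real_inner_le_zero hK hp).1 h⟩
  choose P hPK hP using h
  refine ⟨P, LipschitzWith.of_dist_le_mul fun x y => ?_, hPK, fun x hx => ?_⟩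
  · have h1 := hP x (P y) (hPK y)
    have h2 := hP y (P x) (hPK x)
    have h3 : ‖P x - P y‖ ^ 2 ≤ inner ℝ (x - y) (P x - P y) := by
      rw [← real_inner_self_eq_norm_sq]
      simp only [inner_sub_left, inner_sub_right] at *
      linarith
    have h4 := h3.trans (real_inner_le_norm _ _)
    rw [dist_eq_norm, dist_eq_norm, NNReal.coe_one, one_mul]
    by_contra! hlt
    nlinarith [norm_nonneg (x - y)]
  · have h1 := hP x x hx
    rw [real_inner_self_nonpos, sub_eq_zero] at h1
    exact h1.symm

/-- A trajectory which always heads for a point of a closed convex set does not leave this set. -/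
theorem Convex.mem_of_hasDerivWithinAt_sub {K : Set E} (hcl : IsClosed K) (hK : Convex ℝ K)
    {x : ℝ → E} (h0 : x 0 ∈ K)
    (hx : ∀ t, 0 ≤ t → ∃ b ∈ K, HasDerivWithinAt x (b - x t) (Ici 0) t) {t : ℝ} (ht : 0 ≤ t) :
    x t ∈ K := by
  by_contra hmem
  -- On `K` the separating functional satisfies `φ < c`. The factor `exp s` cancels the term `-x`,
  -- so the derivative of `exp s * (φ (x s) - c)` is `exp s * (φ b - c) < 0`.
  obtain ⟨φ, c, hc, hct⟩ := geometric_hahn_banach_closed_point hK hcl hmem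
  have hd : ∀ s, 0 ≤ s → ∃ b ∈ K, HasDerivWithinAt (fun s => Real.exp s * (φ (x s) - c))
      (Real.exp s * (φ b - c)) (Ici 0) s := by
    intro s hs
    obtain ⟨b, hb, h⟩ := hx s hs
    refine ⟨b, hb, ?_⟩
    have h1 := (φ.hasFDerivAt.comp_hasDerivWithinAt s h).sub_const c
    have h2 := (Real.hasDerivAt_exp s).hasDerivWithinAt.mul h1
    exact h2.congr_deriv (by simp; ring)
  have hanti : AntitoneOn (fun s => Real.exp s * (φ (x s) - c)) (Ici 0) := by
    apply antitoneOn_of_deriv_nonpos (convex_Ici 0)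
    · intro s hs
      obtain ⟨b, _, h⟩ := hd s hs
      exact h.continuousWithinAt
    · intro s hs
      rw [interior_Ici] at hs
      obtain ⟨b, _, h⟩ := hd s (le_of_lt hs)
      exact ((h.hasDerivAt (Ici_mem_nhds hs)).differentiableAt).differentiableWithinAt
    · intro s hs
      rw [interior_Ici] at hs
      obtain ⟨b, hb, h⟩ := hd s (le_of_lt hs)
      rw [(h.hasDerivAt (Ici_mem_nhds hs)).deriv]
      exact mul_nonpos_of_nonneg_of_nonpos (Real.exp_pos s).le (by linarith [hc b hb])
  have h1 := hanti (mem_Ici.2 le_rfl) (mem_Ici.2 ht) ht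
  have h2 := hc _ h0
  have h3 : 0 < Real.exp t * (φ (x t) - c) := mul_pos (Real.exp_pos t) (by linarith)
  simp only [Real.exp_zero, one_mul] at h1
  linarith

/-- The equation `ẋ = H(x) - x` for a Lipschitz self-map `H` of a closed convex set has a solution
on `[0, ∞)` for every initial value in this set. -/
theorem LipschitzOnWith.exists_isIntegralCurveOn_sub [CompleteSpace E] {K : Set E} (hcl : IsClosed K)
    (hK : Convex ℝ K) {H : E → E} {L : ℝ≥0} (hH : LipschitzOnWith L H K) (hmap : MapsTo H K K)
    {x₀ : E} (h0 : x₀ ∈ K) :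
    ∃ x : ℝ → E, x 0 = x₀ ∧ (∀ t, 0 ≤ t → x t ∈ K) ∧
      IsIntegralCurveOn x (fun _ z => H z - z) (Ici 0) := by
  -- `H ∘ P` is a globally Lipschitz extension of `H` with values in `K`; its trajectories stay in
  -- `K`, where `P` is the identity.
  obtain ⟨P, hP, hPK, hPid⟩ := hK.exists_lipschitzWith_one_retraction ⟨x₀, h0⟩ hcl
  have hHP : LipschitzWith (L * 1) (H ∘ P) := by
    rw [← lipschitzOnWith_univ]
    exact hH.comp hP.lipschitzOnWith fun x _ => hPK x
  obtain ⟨x, hx0, hx⟩ := (hHP.sub LipschitzWith.id).exists_hasDerivWithinAt_Ici x₀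
  have hmem : ∀ t, 0 ≤ t → x t ∈ K := fun t ht =>
    hK.mem_of_hasDerivWithinAt_sub hcl (hx0 ▸ h0)
      (fun s hs => ⟨H (P (x s)), hmap (hPK _), hx s hs⟩) ht
  refine ⟨x, hx0, hmem, fun t ht => ?_⟩
  have := hx t ht
  simpa [hPid _ (hmem t ht)] using this

/-- Two solutions of `ẋ = H(x) - x` in a set on which `H` is Lipschitz agree on `[0, ∞)` if they
have the same initial value. -/
theorem LipschitzOnWith.eqOn_of_isIntegralCurveOn_sub {K : Set E} {H : E → E} {L : ℝ≥0}
    (hH : LipschitzOnWith L H K) {x y : ℝ → E} (h0 : x 0 = y 0)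
    (hxK : ∀ t, 0 ≤ t → x t ∈ K) (hyK : ∀ t, 0 ≤ t → y t ∈ K)
    (hx : IsIntegralCurveOn x (fun _ z => H z - z) (Ici 0))
    (hy : IsIntegralCurveOn y (fun _ z => H z - z) (Ici 0)) : EqOn x y (Ici 0) := by
  intro t ht
  exact ODE_solution_unique_of_mem_Icc_right (v := fun _ z => H z - z) (s := fun _ => K)
    (fun s _ => hH.sub (LipschitzWith.id.lipschitzOnWith))
    (hx.continuousOn.mono Icc_subset_Ici_self)
    (fun s hs => (hx s hs.1).mono (Ici_subset_Ici.2 hs.1)) (fun s hs => hxK s hs.1)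
    (hy.continuousOn.mono Icc_subset_Ici_self)
    (fun s hs => (hy s hs.1).mono (Ici_subset_Ici.2 hs.1)) (fun s hs => hyK s hs.1) h0
    (right_mem_Icc.2 ht)

end ODE

/-! ### Projection flows for variational inequalities and the regularized gap. -/

section VariationalInequality

open Set Filter

variable {E : Type*} [NormedAddCommGroup E] [InnerProductSpace ℝ E]

/-- `H` maps the points `x ∈ K` to the solutions `H x ∈ K` of the variational inequality
`⟪F x + A (H x - x), w - H x⟫ ≥ 0`, `w ∈ K`. If `A` is symmetric and positive definite, then `H x`
is the projection of `x - A⁻¹ (F x)` to `K` in the norm given by `A`. -/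
structure IsForwardProjection (K : Set E) (F : E → E) (A : E →L[ℝ] E) (H : E → E) : Prop where
  mapsTo : MapsTo H K K
  inner_nonneg : ∀ x ∈ K, ∀ w ∈ K, 0 ≤ inner ℝ (F x + A (H x - x)) (w - H x)

/-- Fukushima's regularized gap function of the variational inequality for `F`. -/
noncomputable def regularizedGap (F : E → E) (A : E →L[ℝ] E) (H : E → E) (x : E) : ℝ :=
  -inner ℝ (F x) (H x - x) - 1 / 2 * inner ℝ (A (H x - x)) (H x - x)

namespace IsForwardProjection

variable {K : Set E} {F H : E → E} {A : E →L[ℝ] E} {c α : ℝ} {L : ℝ≥0}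

/-- Each of the two variational inequalities is tested with the solution of the other, and the
results are added. -/
theorem inner_sub_nonpos (h : IsForwardProjection K F A H) {x y : E} (hx : x ∈ K) (hy : y ∈ K) :
    inner ℝ (F x - F y + A ((H x - x) - (H y - y))) (H x - H y) ≤ 0 := by
  have h1 := h.inner_nonneg x hx (H y) (h.mapsTo hy)
  have h2 := h.inner_nonneg y hy (H x) (h.mapsTo hx)
  simp only [map_sub, inner_sub_left, inner_sub_right, inner_add_left] at *
  linarith

theorem exists_lipschitzOnWith (h : IsForwardProjection K F A H) (hc : 0 < c)
    (hA : ∀ v, c * ‖v‖ ^ 2 ≤ inner ℝ (A v) v) (hF : LipschitzOnWith L F K) :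
    ∃ M : ℝ≥0, LipschitzOnWith M H K := by
  refine ⟨Real.toNNReal ((‖A‖ + L) / c), LipschitzOnWith.of_dist_le_mul fun x hx y hy => ?_⟩
  rw [Real.coe_toNNReal _ (by positivity), dist_eq_norm, dist_eq_norm]
  have h1 := h.inner_sub_nonpos hx hy
  have h2 : inner ℝ (A (H x - H y)) (H x - H y)
      ≤ inner ℝ (A (x - y) - (F x - F y)) (H x - H y) := by
    simp only [map_sub, inner_sub_left, inner_sub_right, inner_add_left] at *
    linarith
  have h3 := (hA _).trans (h2.trans (real_inner_le_norm _ _))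
  have h4 : ‖A (x - y) - (F x - F y)‖ ≤ (‖A‖ + L) * ‖x - y‖ := by
    refine (norm_sub_le _ _).trans ?_
    rw [add_mul]
    exact add_le_add (A.le_opNorm _) (hF.norm_sub_le hx hy)
  rw [div_mul_eq_mul_div, le_div_iff₀ hc]
  by_contra! hlt
  have h5 : 0 < ‖H x - H y‖ := by
    by_contra! h0
    have : ‖H x - H y‖ = 0 := le_antisymm h0 (norm_nonneg _)
    rw [this, zero_mul] at hlt
    exact absurd hlt (not_lt.2 (by positivity))
  nlinarith

/-- Substituting `H x - H y = (x - y) + δ` in `inner_sub_nonpos` leaves `⟪F x - F y, x - y⟫` bounded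
by terms containing `δ`; strong monotonicity bounds it below by `α ‖x - y‖²`. -/
theorem norm_sub_le (h : IsForwardProjection K F A H)
    (hA : ∀ v, 0 ≤ inner ℝ (A v) v) (hF : LipschitzOnWith L F K) (hα : 0 < α)
    (hmono : ∀ x ∈ K, ∀ y ∈ K, α * ‖x - y‖ ^ 2 ≤ inner ℝ (F x - F y) (x - y))
    {x y : E} (hx : x ∈ K) (hy : y ∈ K) :
    ‖x - y‖ ≤ (L + ‖A‖) / α * ‖(H x - x) - (H y - y)‖ := by
  have h1 := h.inner_sub_nonpos hx hy
  set δ := (H x - x) - (H y - y) with hδ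
  have h2 : H x - H y = (x - y) + δ := by rw [hδ]; abel
  rw [h2] at h1
  simp only [inner_add_left, inner_add_right] at h1
  have h3 := hmono x hx y hy
  have h4 : -inner ℝ (F x - F y) δ ≤ L * ‖x - y‖ * ‖δ‖ := by
    rw [← inner_neg_right]
    refine (real_inner_le_norm _ _).trans ?_
    rw [norm_neg]
    gcongr
    exact hF.norm_sub_le hx hy
  have h5 : -inner ℝ (A δ) (x - y) ≤ ‖A‖ * ‖δ‖ * ‖x - y‖ := by
    rw [← inner_neg_right]
    refine (real_inner_le_norm _ _).trans ?_
    rw [norm_neg]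
    gcongr
    exact A.le_opNorm _
  have h6 := hA δ
  rw [div_mul_eq_mul_div, le_div_iff₀ hα]
  by_contra! hlt
  have h7 : 0 < ‖x - y‖ := by
    by_contra! h0
    have : ‖x - y‖ = 0 := le_antisymm h0 (norm_nonneg _)
    rw [this, zero_mul] at hlt
    exact absurd hlt (not_lt.2 (by positivity))
  nlinarith

theorem le_regularizedGap (h : IsForwardProjection K F A H) {x : E} (hx : x ∈ K) :
    1 / 2 * inner ℝ (A (H x - x)) (H x - x) ≤ regularizedGap F A H x := by
  have h1 := h.inner_nonneg x hx x hx
  rw [← neg_sub (H x) x, inner_neg_right, inner_add_left] at h1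
  unfold regularizedGap
  linarith

theorem regularizedGap_le (hA : ∀ v, 0 ≤ inner ℝ (A v) v) (x : E) :
    regularizedGap F A H x ≤ ‖F x‖ * ‖H x - x‖ := by
  have h1 := hA (H x - x)
  have h2 := real_inner_le_norm (F x) (-(H x - x))
  rw [norm_neg, inner_neg_right] at h2
  unfold regularizedGap
  linarith

theorem continuousOn_regularizedGap (hF : ContinuousOn F K) (hH : ContinuousOn H K) :
    ContinuousOn (regularizedGap F A H) K := by
  unfold regularizedGap
  have hd : ContinuousOn (fun x => H x - x) K := hH.sub continuousOn_id
  exact (hF.inner hd).neg.sub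
    (continuousOn_const.mul ((A.continuous.comp_continuousOn hd).inner hd))

/-- The gap at `x` is the maximum over `w ∈ K` of `-⟪F x, w - x⟫ - ½⟪A (w - x), w - x⟫`, attained at
`H x`. Inserting `w = H y` bounds it below. This replaces differentiation of the gap, for which `F`
would have to be differentiable. -/
theorem regularizedGap_sub_le (h : IsForwardProjection K F A H)
    (hsymm : ∀ u v, inner ℝ (A u) v = inner ℝ u (A v)) (hA : ∀ v, 0 ≤ inner ℝ (A v) v)
    {x y : E} (hx : x ∈ K) (hy : y ∈ K) :
    regularizedGap F A H y - regularizedGap F A H x ≤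
      -inner ℝ (F y - F x) (H y - y) + inner ℝ (F x + A (H y - y)) (y - x)
        + 1 / 2 * inner ℝ (A (y - x)) (y - x) := by
  have h1 := h.inner_nonneg x hx (H y) (h.mapsTo hy)
  have h2 := hA (H y - H x)
  have hs : ∀ u v, inner ℝ (A u) v = inner ℝ (A v) u := fun u v => by
    rw [hsymm u v, real_inner_comm]
  unfold regularizedGap
  simp only [map_sub, inner_sub_left, inner_sub_right, inner_add_left] at *
  rw [hs (H x) (H y), hs x (H y), hs y (H y), hs x y, hs x (H x)] at *
  linarith

/-- Along `ẋ = H(x) - x` the regularized gap decreases at least with rate `α ‖H(x) - x‖²`. -/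
theorem eventually_slope_regularizedGap_lt (h : IsForwardProjection K F A H)
    (hsymm : ∀ u v, inner ℝ (A u) v = inner ℝ u (A v)) (hA : ∀ v, 0 ≤ inner ℝ (A v) v)
    (hF : LipschitzOnWith L F K) (hH : ContinuousOn H K)
    (hmono : ∀ x ∈ K, ∀ y ∈ K, α * ‖x - y‖ ^ 2 ≤ inner ℝ (F x - F y) (x - y))
    {x : ℝ → E} (hxK : ∀ t, 0 ≤ t → x t ∈ K) {t : ℝ} (ht : 0 ≤ t)
    (hx : HasDerivWithinAt x (H (x t) - x t) (Ici 0) t) {r : ℝ}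
    (hr : -(α * ‖H (x t) - x t‖ ^ 2) < r) :
    ∀ᶠ s in 𝓝[>] t, slope (fun s => regularizedGap F A H (x s)) t s < r := by
  set d := H (x t) - x t with hd
  have hsub : Ioi t ⊆ Ici 0 := fun s hs => ht.trans (le_of_lt hs)
  have hp : Tendsto (slope x t) (𝓝[>] t) (𝓝 d) :=
    (hasDerivWithinAt_iff_tendsto_slope' (lt_irrefl t)).1 (hx.mono hsub)
  have hxt : Tendsto x (𝓝[>] t) (𝓝 (x t)) := hx.continuousWithinAt.mono hsub
  have hmem : ∀ᶠ s in 𝓝[>] t, x s ∈ K :=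
    eventually_nhdsWithin_of_forall fun s hs => hxK s (hsub hs)
  have hd' : Tendsto (fun s => H (x s) - x s) (𝓝[>] t) (𝓝 d) :=
    ((hH (x t) (hxK t ht)).tendsto.comp (tendsto_nhdsWithin_iff.2 ⟨hxt, hmem⟩)).sub hxt
  have hh : Tendsto (fun s => s - t) (𝓝[>] t) (𝓝 0) := by
    have : Tendsto (fun s => s - t) (𝓝 t) (𝓝 (t - t)) := (continuous_id.sub continuous_const).tendsto t
    rw [sub_self] at this
    exact this.mono_left nhdsWithin_le_nhds
  -- This expression is an upper bound for the difference quotient: in `-⟪F (x s) - F (x t), H (x s)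
  -- - x s⟫` the slope `p` is split off, monotonicity handles `p`, and the Lipschitz bound handles
  -- the remainder, which tends to zero.
  have hlim : Tendsto (fun s => -(α * ‖slope x t s‖ ^ 2)
      + L * ‖slope x t s‖ * ‖H (x s) - x s - slope x t s‖
      + inner ℝ (F (x t) + A (H (x s) - x s)) (slope x t s)
      + 1 / 2 * (s - t) * inner ℝ (A (slope x t s)) (slope x t s)) (𝓝[>] t)
      (𝓝 (-(α * ‖d‖ ^ 2) + L * ‖d‖ * ‖d - d‖ + inner ℝ (F (x t) + A d) d
        + 1 / 2 * 0 * inner ℝ (A d) d)) := by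
    refine ((((hp.norm.pow 2).const_mul α).neg.add ((hp.norm.const_mul _).mul
      (hd'.sub hp).norm)).add ((tendsto_const_nhds.add ((A.continuous.tendsto _).comp hd')).inner
      hp)).add ((hh.const_mul _).mul (((A.continuous.tendsto _).comp hp).inner hp))
  have hlt : -(α * ‖d‖ ^ 2) + L * ‖d‖ * ‖d - d‖ + inner ℝ (F (x t) + A d) d
        + 1 / 2 * 0 * inner ℝ (A d) d < r := by
    -- Tested with `w = x t`, the variational inequality says `⟪F (x t) + A d, d⟫ ≤ 0`.
    have h1 := h.inner_nonneg (x t) (hxK t ht) (x t) (hxK t ht)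
    rw [← neg_sub (H (x t)) (x t), inner_neg_right, ← hd] at h1
    simp only [sub_self, norm_zero, mul_zero, zero_mul, add_zero]
    linarith
  filter_upwards [hlim.eventually_lt_const hlt, hmem, self_mem_nhdsWithin] with s hs hsK hts
  refine lt_of_le_of_lt ?_ hs
  have hst : 0 < s - t := sub_pos.2 hts
  set p := slope x t s with hpdef
  have hxp : x s - x t = (s - t) • p := (sub_smul_slope x t s).symm
  have h1 := h.regularizedGap_sub_le hsymm hA (hxK t ht) hsK
  have h2 := hmono (x s) hsK (x t) (hxK t ht)
  have h3 := hF.norm_sub_le hsK (hxK t ht)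
  rw [hxp] at h1 h2 h3
  simp only [inner_smul_right, norm_smul, Real.norm_eq_abs, abs_of_pos hst, map_smul,
    real_inner_smul_left] at h1 h2 h3
  have h2' : α * (s - t) * ‖p‖ ^ 2 ≤ inner ℝ (F (x s) - F (x t)) p := by
    refine le_of_mul_le_mul_left ?_ hst
    linarith
  have h4 : -inner ℝ (F (x s) - F (x t)) (H (x s) - x s - p)
      ≤ L * ((s - t) * ‖p‖) * ‖H (x s) - x s - p‖ := by
    rw [← inner_neg_right]
    refine (real_inner_le_norm _ _).trans ?_
    rw [norm_neg]
    gcongr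
  rw [inner_sub_right] at h4
  rw [slope_def_field, div_le_iff₀ hst]
  linarith

/-- If `F` is strongly monotone and Lipschitz on `K`, then every trajectory of `ẋ = H(x) - x` in `K`
converges to a fixed point of `H`. -/
theorem exists_tendsto_fixedPoint [CompleteSpace E] (h : IsForwardProjection K F A H)
    (hcl : IsClosed K) (hsymm : ∀ u v, inner ℝ (A u) v = inner ℝ u (A v)) (hc : 0 < c)
    (hA : ∀ v, c * ‖v‖ ^ 2 ≤ inner ℝ (A v) v) (hF : LipschitzOnWith L F K) (hα : 0 < α)
    (hmono : ∀ x ∈ K, ∀ y ∈ K, α * ‖x - y‖ ^ 2 ≤ inner ℝ (F x - F y) (x - y))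
    {x : ℝ → E} (hxK : ∀ t, 0 ≤ t → x t ∈ K)
    (hx : IsIntegralCurveOn x (fun _ z => H z - z) (Ici 0)) :
    ∃ p ∈ K, H p = p ∧ Tendsto x atTop (𝓝 p) := by
  have hA0 : ∀ v, 0 ≤ inner ℝ (A v) v := fun v => le_trans (by positivity) (hA v)
  obtain ⟨M, hM⟩ := h.exists_lipschitzOnWith hc hA hF
  set W : ℝ → ℝ := fun t => regularizedGap F A H (x t) with hW
  set d : ℝ → E := fun t => H (x t) - x t with hddef
  have hWcont : ContinuousOn W (Ici 0) :=
    (continuousOn_regularizedGap hF.continuousOn hM.continuousOn).comp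
      hx.continuousOn hxK
  -- Only right difference quotients of `W` are controlled, so a comparison principle replaces the
  -- mean value theorem.
  have hdecay : ∀ a b m, 0 ≤ a → a ≤ b → (∀ s ∈ Ico a b, m ≤ α * ‖d s‖ ^ 2) →
      W b ≤ W a - m * (b - a) := by
    intro a b m ha hab hm
    refine image_le_of_liminf_slope_right_le_deriv_boundary (f := W)
      (B := fun t => W a - m * (t - a)) (B' := fun _ => -m)
      (hWcont.mono (Icc_subset_Ici_self.trans (Ici_subset_Ici.2 ha))) (by simp)
      (by fun_prop) ?_ ?_ (right_mem_Icc.2 hab)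
    · intro s _
      have := (((hasDerivAt_id s).sub_const a).const_mul m).const_sub (W a)
      exact (this.congr_deriv (by simp)).hasDerivWithinAt
    · intro s hs r hr
      have h0 : 0 ≤ s := ha.trans hs.1
      refine (h.eventually_slope_regularizedGap_lt hsymm hA0 hF hM.continuousOn hmono hxK h0
        (hx s h0) ?_).frequently
      exact (neg_le_neg (hm s hs)).trans_lt hr
  have hanti : ∀ a b, 0 ≤ a → a ≤ b → W b ≤ W a := by
    intro a b ha hab
    simpa using hdecay a b 0 ha hab fun s _ => by positivity
  have hWd : ∀ t, 0 ≤ t → c / 2 * ‖d t‖ ^ 2 ≤ W t := by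
    intro t ht
    have h1 := h.le_regularizedGap (hxK t ht)
    have h2 := hA (d t)
    simp only [hW, hddef] at *
    linarith
  have hW0 : ∀ t, 0 ≤ t → 0 ≤ W t := fun t ht => le_trans (by positivity) (hWd t ht)
  set C : ℝ := (L + ‖A‖) / α with hC
  have hC0 : 0 ≤ C := by positivity
  have herr : ∀ s t, 0 ≤ s → 0 ≤ t → ‖x s - x t‖ ≤ C * (‖d s‖ + ‖d t‖) := fun s t hs ht =>
    (h.norm_sub_le hA0 hF hα hmono (hxK s hs) (hxK t ht)).trans
      (mul_le_mul_of_nonneg_left (_root_.norm_sub_le _ _) hC0)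
  set D : ℝ := Real.sqrt (2 * W 0 / c) with hD
  have hdD : ∀ t, 0 ≤ t → ‖d t‖ ≤ D := by
    intro t ht
    apply Real.le_sqrt_of_sq_le
    rw [le_div_iff₀ hc]
    linarith [hWd t ht, hanti 0 t le_rfl ht]
  -- The error bound confines the trajectory to a ball around `x 0`, so `F` is bounded along it; the
  -- `1` makes `B` positive.
  set B : ℝ := ‖F (x 0)‖ + L * (C * (D + D)) + 1 with hB
  have hD0 : 0 ≤ D := Real.sqrt_nonneg _
  have hB0 : 0 < B := by positivity
  have hFB : ∀ t, 0 ≤ t → ‖F (x t)‖ ≤ B := by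
    intro t ht
    have h1 := norm_le_norm_add_norm_sub' (F (x t)) (F (x 0))
    have h2 := hF.norm_sub_le (hxK t ht) (hxK 0 le_rfl)
    have h3 : (L : ℝ) * ‖x t - x 0‖ ≤ L * (C * (D + D)) := by
      gcongr
      exact (herr t 0 ht le_rfl).trans (by gcongr <;> [exact hdD t ht; exact hdD 0 le_rfl])
    linarith
  have hWB : ∀ t, 0 ≤ t → W t ≤ B * ‖d t‖ := fun t ht =>
    (regularizedGap_le hA0 _).trans (mul_le_mul_of_nonneg_right (hFB t ht) (norm_nonneg _))
  have hWlim : ∀ ε > 0, ∃ T, 0 ≤ T ∧ ∀ t, T ≤ t → W t < ε := by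
    intro ε hε
    by_contra! hcon
    have hWε : ∀ t, 0 ≤ t → ε ≤ W t := by
      intro t ht
      obtain ⟨s, hs, h1⟩ := hcon t ht
      exact h1.trans (hanti t s ht hs)
    -- If `W ≥ ε` forever, then `‖d‖ ≥ ε / B`, and the linear decay of `W` would bring it to zero in
    -- finite time.
    have hm : 0 < α * (ε / B) ^ 2 := by positivity
    have h1 : ∀ T, 0 ≤ T → W T ≤ W 0 - α * (ε / B) ^ 2 * (T - 0) := by
      intro T hT
      refine hdecay 0 T _ le_rfl hT fun s hs => ?_
      gcongr
      rw [div_le_iff₀' hB0]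
      exact (hWε s hs.1).trans (hWB s hs.1)
    have hT : 0 ≤ W 0 / (α * (ε / B) ^ 2) := div_nonneg (hW0 0 le_rfl) hm.le
    have h2 := h1 _ hT
    rw [sub_zero, mul_div_cancel₀ _ hm.ne', sub_self] at h2
    linarith [hWε _ hT]
  have hdlim : Tendsto d atTop (𝓝 0) := by
    rw [Metric.tendsto_atTop]
    intro ε hε
    obtain ⟨T, hT0, hT⟩ := hWlim (c / 2 * ε ^ 2) (by positivity)
    refine ⟨T, fun t ht => ?_⟩
    rw [dist_zero_right]
    have h1 := (hWd t (hT0.trans ht)).trans_lt (hT t ht)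
    exact lt_of_pow_lt_pow_left₀ 2 hε.le (lt_of_mul_lt_mul_left h1 (by positivity))
  have hcauchy : CauchySeq x := by
    rw [Metric.cauchySeq_iff']
    intro ε hε
    obtain ⟨T, hT⟩ := (Metric.tendsto_atTop.1 hdlim) (ε / (2 * (C + 1))) (by positivity)
    refine ⟨max T 0, fun t ht => ?_⟩
    rw [dist_eq_norm]
    have h1 := hT t ((le_max_left _ _).trans ht)
    have h2 := hT _ (le_max_left T 0)
    rw [dist_zero_right] at h1 h2
    rw [lt_div_iff₀ (by positivity)] at h1 h2
    have h3 := herr t _ ((le_max_right T 0).trans ht) (le_max_right T 0)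
    nlinarith [norm_nonneg (d t), norm_nonneg (d (max T 0))]
  obtain ⟨p, hp⟩ := cauchySeq_tendsto_of_complete hcauchy
  have hmem : ∀ᶠ t in atTop, x t ∈ K := (eventually_ge_atTop 0).mono hxK
  have hpK : p ∈ K := hcl.mem_of_tendsto hp hmem
  refine ⟨p, hpK, ?_, hp⟩
  have h1 : Tendsto d atTop (𝓝 (H p - p)) :=
    ((hM.continuousOn p hpK).tendsto.comp (tendsto_nhdsWithin_iff.2 ⟨hp, hmem⟩)).sub hp
  exact sub_eq_zero.1 (tendsto_nhds_unique h1 hdlim)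

end IsForwardProjection

end VariationalInequality

/-! ### Componentwise differentiation in Euclidean products. -/

theorem PiLp.hasDerivWithinAt_iff {ι : Type*} [Fintype ι] {E : ι → Type*}
    [∀ i, NormedAddCommGroup (E i)] [∀ i, NormedSpace ℝ (E i)] {x : ℝ → PiLp 2 E} {x' : PiLp 2 E}
    {s : Set ℝ} {t : ℝ} :
    HasDerivWithinAt x x' s t ↔ ∀ i, HasDerivWithinAt (fun r => x r i) (x' i) s t := by
  rw [hasDerivWithinAt_iff_hasFDerivWithinAt, hasFDerivWithinAt_piLp]
  refine forall_congr' fun i => ?_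
  rw [hasDerivWithinAt_iff_hasFDerivWithinAt]
  have h : PiLp.proj 2 E i ∘L ContinuousLinearMap.toSpanSingleton ℝ x' =
      ContinuousLinearMap.toSpanSingleton ℝ (x' i) := by
    ext1
    simp
  rw [h]

theorem PiLp.isIntegralCurveOn_iff {ι : Type*} [Fintype ι] {E : ι → Type*}
    [∀ i, NormedAddCommGroup (E i)] [∀ i, NormedSpace ℝ (E i)] {x : ℝ → PiLp 2 E}
    {v : ℝ → PiLp 2 E → PiLp 2 E} {s : Set ℝ} :
    IsIntegralCurveOn x v s ↔
      ∀ t ∈ s, ∀ i, HasDerivWithinAt (fun r => x r i) (v t (x t) i) s t :=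
  forall₂_congr fun _ _ => PiLp.hasDerivWithinAt_iff

/-! ### Minimization of positive definite quadratic functions. -/

section Quadratic

open Filter

variable {E : Type*} [NormedAddCommGroup E] [InnerProductSpace ℝ E]

theorem ContinuousLinearMap.exists_pos_mul_norm_sq_le_inner [FiniteDimensional ℝ E] (A : E →L[ℝ] E)
    (hA : ∀ v, v ≠ 0 → 0 < inner ℝ (A v) v) :
    ∃ c : ℝ, 0 < c ∧ ∀ v, c * ‖v‖ ^ 2 ≤ inner ℝ (A v) v := by
  -- The unit sphere is empty only in the trivial space; otherwise `c` is the minimum of the form on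
  -- it.
  rcases (Metric.sphere (0 : E) 1).eq_empty_or_nonempty with h | h
  · refine ⟨1, one_pos, fun v => ?_⟩
    have hv : v = 0 := by
      by_contra hv
      have h1 : ‖v‖⁻¹ • v ∈ Metric.sphere (0 : E) 1 := by
        simp [norm_smul, inv_mul_cancel₀ (norm_ne_zero_iff.2 hv)]
      rw [h] at h1
      exact h1
    simp [hv]
  · obtain ⟨u, hu, hmin⟩ := (isCompact_sphere (0 : E) 1).exists_isMinOn h
      (f := fun v => inner ℝ (A v) v) (A.continuous.inner continuous_id).continuousOn
    have hu0 : u ≠ 0 := ne_zero_of_mem_unit_sphere ⟨u, hu⟩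
    refine ⟨inner ℝ (A u) u, hA u hu0, fun v => ?_⟩
    rcases eq_or_ne v 0 with rfl | hv
    · simp
    have hv' : ‖v‖ ≠ 0 := norm_ne_zero_iff.2 hv
    have h1 : ‖v‖⁻¹ • v ∈ Metric.sphere (0 : E) 1 := by
      simp [norm_smul, inv_mul_cancel₀ hv']
    have h2 := hmin h1
    simp only [Set.mem_ofPred_eq, map_smul, real_inner_smul_left, inner_smul_right] at h2
    calc inner ℝ (A u) u * ‖v‖ ^ 2
        ≤ (‖v‖⁻¹ * (‖v‖⁻¹ * inner ℝ (A v) v)) * ‖v‖ ^ 2 := by gcongr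
      _ = inner ℝ (A v) v := by field_simp

/-- A quadratic function with positive definite quadratic part attains its minimum on every
nonempty closed set. -/
theorem IsClosed.exists_forall_quadratic_le [FiniteDimensional ℝ E] {K : Set E} (hK : IsClosed K)
    (hne : K.Nonempty) {A : E →L[ℝ] E} {c : ℝ} (hc : 0 < c)
    (hA : ∀ v, c * ‖v‖ ^ 2 ≤ inner ℝ (A v) v) (b : E) :
    ∃ y ∈ K, ∀ w ∈ K, 1 / 2 * inner ℝ (A y) y + inner ℝ b y ≤
      1 / 2 * inner ℝ (A w) w + inner ℝ b w := by
  obtain ⟨x₀, hx₀⟩ := hne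
  set φ : E → ℝ := fun y => 1 / 2 * inner ℝ (A y) y + inner ℝ b y with hφ
  have hcont : Continuous φ := (continuous_const.mul (A.continuous.inner continuous_id)).add
    (continuous_const.inner continuous_id)
  have hlim : Tendsto φ (cocompact E) atTop := by
    have h1 : Tendsto (fun r : ℝ => r * (c / 2 * r - ‖b‖)) atTop atTop :=
      tendsto_id.atTop_mul_atTop₀
        (tendsto_atTop_add_const_right _ _ (tendsto_id.const_mul_atTop (by positivity)))
    refine tendsto_atTop_mono (fun y => ?_) (h1.comp (tendsto_norm_cocompact_atTop (E := E)))
    have h2 := hA y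
    have h3 := real_inner_le_norm b (-y)
    rw [inner_neg_right, norm_neg] at h3
    simp only [Function.comp_apply, hφ]
    linarith
  obtain ⟨y, hy, hmin⟩ := hcont.continuousOn.exists_isMinOn' hK hx₀
    ((hlim.eventually_ge_atTop (φ x₀)).filter_mono inf_le_left)
  exact ⟨y, hy, fun w hw => hmin hw⟩

/-- First-order optimality condition for a quadratic function on a convex set. -/
theorem Convex.inner_nonneg_of_quadratic_le {K : Set E} (hK : Convex ℝ K) {A : E →L[ℝ] E}
    (hsymm : ∀ u v, inner ℝ (A u) v = inner ℝ u (A v)) {b y : E} (hy : y ∈ K)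
    (hmin : ∀ w ∈ K, 1 / 2 * inner ℝ (A y) y + inner ℝ b y ≤
      1 / 2 * inner ℝ (A w) w + inner ℝ b w) {w : E} (hw : w ∈ K) :
    0 ≤ inner ℝ (A y + b) (w - y) := by
  -- Compare `y` with `y + t (w - y)`, divide by `t`, and let `t` tend to zero.
  have h1 : ∀ t : ℝ, t ∈ Set.Ioo 0 1 →
      0 ≤ inner ℝ (A y + b) (w - y) + t * (1 / 2 * inner ℝ (A (w - y)) (w - y)) := by
    intro t ht
    have h2 := hmin _ (hK.add_smul_sub_mem hy hw ⟨ht.1.le, ht.2.le⟩)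
    have h3 : inner ℝ (A (w - y)) y = inner ℝ (A y) (w - y) := by
      rw [hsymm, real_inner_comm]
    refine nonneg_of_mul_nonneg_right ?_ ht.1
    simp only [map_add, map_smul, inner_add_left, inner_add_right, real_inner_smul_left,
      inner_smul_right, h3] at h2 ⊢
    linarith
  have h2 : Tendsto (fun t : ℝ => inner ℝ (A y + b) (w - y)
      + t * (1 / 2 * inner ℝ (A (w - y)) (w - y))) (𝓝[>] 0)
      (𝓝 (inner ℝ (A y + b) (w - y) + 0 * (1 / 2 * inner ℝ (A (w - y)) (w - y)))) :=
    (tendsto_const_nhds.add (tendsto_id.mul_const _)).mono_left nhdsWithin_le_nhds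
  rw [zero_mul, add_zero] at h2
  refine ge_of_tendsto h2 ?_
  filter_upwards [Ioo_mem_nhdsGT one_pos] with t ht using h1 t ht

theorem hasGradientAt_quadratic [CompleteSpace E] {A : E →L[ℝ] E}
    (hsymm : ∀ u v, inner ℝ (A u) v = inner ℝ u (A v)) (b y : E) :
    HasGradientAt (fun w => 1 / 2 * inner ℝ (A w) w + inner ℝ b w) (A y + b) y := by
  rw [hasGradientAt_iff_hasFDerivAt]
  have h1 := ((A.hasFDerivAt (x := y)).inner ℝ (hasFDerivAt_id y)).const_mul (1 / 2 : ℝ)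
  have h2 := (hasFDerivAt_const b y).inner ℝ (hasFDerivAt_id y)
  refine (h1.add h2).congr_fderiv ?_
  ext v
  have h3 : inner ℝ (A v) y = inner ℝ (A y) v := by rw [hsymm, real_inner_comm]
  simp [h3]
  ring

end Quadratic

/-! ### Matrices as operators and the block diagonal metric. -/

section Matrices

variable {N n : ℕ}

theorem weightedNormSq_eq_inner (Q : Matrix (Fin n) (Fin n) ℝ) (x : EuclideanSpace ℝ (Fin n)) :
    weightedNormSq Q x = inner ℝ (Matrix.toEuclideanCLM (𝕜 := ℝ) Q x) x := by
  simp [weightedNormSq, EuclideanSpace.inner_eq_star_dotProduct]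

theorem Matrix.IsHermitian.inner_toEuclideanCLM {Q : Matrix (Fin n) (Fin n) ℝ}
    (hQ : Q.IsHermitian) (u v : EuclideanSpace ℝ (Fin n)) :
    inner ℝ (Matrix.toEuclideanCLM (𝕜 := ℝ) Q u) v =
      inner ℝ u (Matrix.toEuclideanCLM (𝕜 := ℝ) Q v) :=
  Matrix.isSymmetric_toEuclideanLin_iff.2 hQ u v

theorem Matrix.PosDef.inner_toEuclideanCLM_pos {Q : Matrix (Fin n) (Fin n) ℝ} (hQ : Q.PosDef)
    {v : EuclideanSpace ℝ (Fin n)} (hv : v ≠ 0) :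
    0 < inner ℝ (Matrix.toEuclideanCLM (𝕜 := ℝ) Q v) v := by
  rw [← weightedNormSq_eq_inner]
  have := hQ.dotProduct_mulVec_pos (x := v.ofLp) (by simpa using hv)
  simpa [weightedNormSq] using this

/-- The block diagonal operator on profiles with the matrices `Qⁱ` as its blocks. -/
noncomputable def blockDiagonalCLM (Q : Fin N → Matrix (Fin n) (Fin n) ℝ) :
    Profile N n →L[ℝ] Profile N n :=
  (PiLp.continuousLinearEquiv 2 ℝ
    (fun _ : Fin N => EuclideanSpace ℝ (Fin n))).symm.toContinuousLinearMap ∘L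
    ContinuousLinearMap.pi fun i =>
      Matrix.toEuclideanCLM (𝕜 := ℝ) (Q i) ∘L
        PiLp.proj 2 (fun _ : Fin N => EuclideanSpace ℝ (Fin n)) i

theorem Profile.inner_eq_sum (x y : Profile N n) : inner ℝ x y = ∑ i, inner ℝ (x i) (y i) :=
  PiLp.inner_apply x y

@[simp]
theorem blockDiagonalCLM_apply (Q : Fin N → Matrix (Fin n) (Fin n) ℝ) (x : Profile N n)
    (i : Fin N) :
    blockDiagonalCLM Q x i = Matrix.toEuclideanCLM (𝕜 := ℝ) (Q i) (x i) := rfl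

theorem inner_blockDiagonalCLM {Q : Fin N → Matrix (Fin n) (Fin n) ℝ}
    (hQ : ∀ i, (Q i).IsHermitian) (u v : Profile N n) :
    inner ℝ (blockDiagonalCLM Q u) v = inner ℝ u (blockDiagonalCLM Q v) := by
  simp only [Profile.inner_eq_sum, blockDiagonalCLM_apply, (hQ _).inner_toEuclideanCLM]

theorem inner_blockDiagonalCLM_pos {Q : Fin N → Matrix (Fin n) (Fin n) ℝ}
    (hQ : ∀ i, (Q i).PosDef) {v : Profile N n} (hv : v ≠ 0) :
    0 < inner ℝ (blockDiagonalCLM Q v) v := by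
  simp only [Profile.inner_eq_sum, blockDiagonalCLM_apply]
  obtain ⟨i, hi⟩ : ∃ i, v i ≠ 0 := by
    by_contra! h
    exact hv (PiLp.ext h)
  refine Finset.sum_pos' (fun j _ => ?_) ⟨i, Finset.mem_univ i, (hQ i).inner_toEuclideanCLM_pos hi⟩
  rcases eq_or_ne (v j) 0 with h | h
  · simp [h]
  · exact ((hQ j).inner_toEuclideanCLM_pos h).le

end Matrices

/-! ### Feasible profiles, Lipschitz game Jacobian and feasibility of trajectories. -/

namespace NetworkGame

variable {N n : ℕ} (g : NetworkGame N n)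

theorem isClosed_profiles (h : ∀ i, IsClosed (g.feasible i)) : IsClosed g.profiles := by
  have : g.profiles = ⋂ i, (fun x : Profile N n => x i) ⁻¹' g.feasible i := by
    ext x; simp [profiles]
  rw [this]
  exact isClosed_iInter fun i => (h i).preimage (PiLp.continuous_apply 2 _ i)

theorem convex_profiles (h : ∀ i, Convex ℝ (g.feasible i)) : Convex ℝ g.profiles :=
  fun _ hx _ hy _ _ ha hb hab i => h i (hx i) (hy i) ha hb hab

theorem nonempty_profiles (h : ∀ i, (g.feasible i).Nonempty) : g.profiles.Nonempty := by
  choose x hx using h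
  exact ⟨WithLp.toLp 2 x, hx⟩

theorem exists_lipschitzWith_aggregate (i : Fin N) :
    ∃ K : ℝ≥0, LipschitzWith K (g.aggregate i) := by
  let T : Profile N n →L[ℝ] EuclideanSpace ℝ (Fin n) :=
    ∑ j, g.adj i j • PiLp.proj 2 (fun _ : Fin N => EuclideanSpace ℝ (Fin n)) j
  have hT : g.aggregate i = T := by
    ext1 x
    simp [aggregate, T]
  rw [hT]
  exact ⟨_, T.lipschitz⟩

theorem IsRegular.exists_lipschitzOnWith_gameJacobian {g : NetworkGame N n} (hreg : g.IsRegular) :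
    ∃ L : ℝ≥0, LipschitzOnWith L g.gameJacobian g.profiles := by
  choose K hK using hreg.lipschitz_gradient
  choose M hM using g.exists_lipschitzWith_aggregate
  have h1 : ∀ i, LipschitzOnWith (K i * max 1 (M i))
      (fun x : Profile N n => g.ownGradient i (x i) (g.aggregate i x)) g.profiles := by
    intro i
    have h2 : LipschitzWith (max 1 (M i)) (fun x : Profile N n => (x i, g.aggregate i x)) :=
      LipschitzWith.prodMk (LipschitzWith.of_dist_le_mul fun x y => by
        simpa using PiLp.dist_apply_le x y i) (hM i)
    change LipschitzOnWith _ ((fun q : EuclideanSpace ℝ (Fin n) × EuclideanSpace ℝ (Fin n) =>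
      g.ownGradient i q.1 q.2) ∘ fun x : Profile N n => (x i, g.aggregate i x)) _
    exact (hK i).comp h2.lipschitzOnWith fun x hx => ⟨hx i, x, hx, rfl⟩
  have h3 : LipschitzOnWith (∑ i, K i * max 1 (M i))
      (fun (x : Profile N n) i => g.ownGradient i (x i) (g.aggregate i x)) g.profiles :=
    LipschitzOnWith.of_dist_le_mul fun x hx y hy => by
      rw [dist_pi_le_iff (by positivity)]
      intro i
      refine ((h1 i).dist_le_mul x hx y hy).trans ?_
      gcongr
      exact Finset.single_le_sum (f := fun i => K i * max 1 (M i)) (fun _ _ => zero_le)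
        (Finset.mem_univ i)
  exact ⟨_, (PiLp.lipschitzWith_toLp 2 _).comp_lipschitzOnWith h3⟩

/-- Trajectories are not feasible by definition, but every block heads for a point of the closed
convex set `Xⁱ`. -/
theorem IsBRTrajectory.mem_profiles {g : NetworkGame N n} (hcl : ∀ i, IsClosed (g.feasible i))
    (hconv : ∀ i, Convex ℝ (g.feasible i)) {x₀ : Profile N n} (h0 : x₀ ∈ g.profiles)
    {x : ℝ → Profile N n} (hx : g.IsBRTrajectory x₀ x) {t : ℝ} (ht : 0 ≤ t) :
    x t ∈ g.profiles := fun i =>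
  (hconv i).mem_of_hasDerivWithinAt_sub (x := fun s => x s i) (hcl i) (by
    simpa [hx.1] using h0 i) (fun s hs => by
      obtain ⟨b, hb, hd⟩ := hx.2 s hs i
      exact ⟨b, hb.1, hd⟩) ht

end NetworkGame

/-! ### Best responses to quadratic costs as a forward projection. -/

namespace NetworkGame

variable {N n : ℕ} {g : NetworkGame N n} {Q : Fin N → Matrix (Fin n) (Fin n) ℝ}
  {f : Fin N → EuclideanSpace ℝ (Fin n) → EuclideanSpace ℝ (Fin n)}

theorem bestResponse_eq_of_quadratic
    (hcost : ∀ i y z, g.cost i y z = 1 / 2 * weightedNormSq (Q i) y + inner ℝ (f i z) y)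
    (i : Fin N) (z : EuclideanSpace ℝ (Fin n)) :
    g.bestResponse i z = {y | y ∈ g.feasible i ∧ ∀ w ∈ g.feasible i,
      1 / 2 * inner ℝ (Matrix.toEuclideanCLM (𝕜 := ℝ) (Q i) y) y + inner ℝ (f i z) y ≤
        1 / 2 * inner ℝ (Matrix.toEuclideanCLM (𝕜 := ℝ) (Q i) w) w + inner ℝ (f i z) w} := by
  simp only [bestResponse, hcost, weightedNormSq_eq_inner]

theorem bestResponse_nonempty_of_quadratic (hreg : g.IsRegular) (hQ : ∀ i, (Q i).PosDef)
    (hcost : ∀ i y z, g.cost i y z = 1 / 2 * weightedNormSq (Q i) y + inner ℝ (f i z) y)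
    (i : Fin N) (z : EuclideanSpace ℝ (Fin n)) : (g.bestResponse i z).Nonempty := by
  obtain ⟨c, hc, hqc⟩ := ContinuousLinearMap.exists_pos_mul_norm_sq_le_inner
    (Matrix.toEuclideanCLM (𝕜 := ℝ) (Q i)) fun v hv => (hQ i).inner_toEuclideanCLM_pos hv
  rw [bestResponse_eq_of_quadratic hcost]
  exact (hreg.isClosed i).exists_forall_quadratic_le (hreg.nonempty i) hc hqc (f i z)

theorem inner_nonneg_of_mem_bestResponse (hconv : ∀ i, Convex ℝ (g.feasible i))
    (hQ : ∀ i, (Q i).PosDef)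
    (hcost : ∀ i y z, g.cost i y z = 1 / 2 * weightedNormSq (Q i) y + inner ℝ (f i z) y)
    {i : Fin N} {y z w : EuclideanSpace ℝ (Fin n)} (hy : y ∈ g.bestResponse i z)
    (hw : w ∈ g.feasible i) :
    0 ≤ inner ℝ (Matrix.toEuclideanCLM (𝕜 := ℝ) (Q i) y + f i z) (w - y) := by
  rw [bestResponse_eq_of_quadratic hcost] at hy
  exact (hconv i).inner_nonneg_of_quadratic_le (hQ i).isHermitian.inner_toEuclideanCLM hy.1 hy.2 hw

/-- Adding the optimality conditions of two minimizers gives `⟪Q (y - w), y - w⟫ ≤ 0`. -/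
theorem bestResponse_subsingleton_of_quadratic (hconv : ∀ i, Convex ℝ (g.feasible i))
    (hQ : ∀ i, (Q i).PosDef)
    (hcost : ∀ i y z, g.cost i y z = 1 / 2 * weightedNormSq (Q i) y + inner ℝ (f i z) y)
    (i : Fin N) (z : EuclideanSpace ℝ (Fin n)) : (g.bestResponse i z).Subsingleton := by
  intro y hy w hw
  have h1 := inner_nonneg_of_mem_bestResponse hconv hQ hcost hy hw.1
  have h2 := inner_nonneg_of_mem_bestResponse hconv hQ hcost hw hy.1
  by_contra hne
  have h3 := (hQ i).inner_toEuclideanCLM_pos (sub_ne_zero.2 hne)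
  simp only [map_sub, inner_sub_left, inner_sub_right, inner_add_left] at h1 h2 h3
  linarith

theorem gameJacobian_apply_of_quadratic (hQ : ∀ i, (Q i).PosDef)
    (hcost : ∀ i y z, g.cost i y z = 1 / 2 * weightedNormSq (Q i) y + inner ℝ (f i z) y)
    (x : Profile N n) (i : Fin N) :
    g.gameJacobian x i =
      Matrix.toEuclideanCLM (𝕜 := ℝ) (Q i) (x i) + f i (g.aggregate i x) := by
  have h := (hasGradientAt_quadratic (hQ i).isHermitian.inner_toEuclideanCLM
    (f i (g.aggregate i x)) (x i)).gradient
  simp only [gameJacobian, ownGradient, hcost, weightedNormSq_eq_inner]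
  exact h

/-- The terms `Qⁱ xⁱ` cancel in `F x + A (H x - x)`, leaving the own gradients at the best
responses; the inequality on the product is the sum of the players' optimality conditions. -/
theorem isForwardProjection_of_mem_bestResponse (hconv : ∀ i, Convex ℝ (g.feasible i))
    (hQ : ∀ i, (Q i).PosDef)
    (hcost : ∀ i y z, g.cost i y z = 1 / 2 * weightedNormSq (Q i) y + inner ℝ (f i z) y)
    {H : Profile N n → Profile N n} (hH : ∀ x i, H x i ∈ g.bestResponse i (g.aggregate i x)) :
    IsForwardProjection g.profiles g.gameJacobian (blockDiagonalCLM Q) H := by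
  refine ⟨fun x _ i => (hH x i).1, fun x _ w hw => ?_⟩
  rw [Profile.inner_eq_sum]
  refine Finset.sum_nonneg fun i _ => ?_
  have h1 := inner_nonneg_of_mem_bestResponse hconv hQ hcost (hH x i) (hw i)
  have h2 : (g.gameJacobian x + blockDiagonalCLM Q (H x - x)) i =
      Matrix.toEuclideanCLM (𝕜 := ℝ) (Q i) (H x i) + f i (g.aggregate i x) := by
    rw [PiLp.add_apply, gameJacobian_apply_of_quadratic hQ hcost, blockDiagonalCLM_apply,
      PiLp.sub_apply, map_sub]
    abel
  rw [h2]
  exact h1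

theorem isBRTrajectory_iff {H : Profile N n → Profile N n}
    (hH : ∀ x i, H x i ∈ g.bestResponse i (g.aggregate i x))
    (hsub : ∀ i z, (g.bestResponse i z).Subsingleton) {x₀ : Profile N n} {x : ℝ → Profile N n} :
    g.IsBRTrajectory x₀ x ↔
      x 0 = x₀ ∧ IsIntegralCurveOn x (fun _ z => H z - z) (Set.Ici 0) := by
  rw [PiLp.isIntegralCurveOn_iff]
  refine and_congr_right fun _ => forall₂_congr fun t _ => forall_congr' fun i => ⟨?_, fun h => ⟨_, hH (x t) i, h⟩⟩
  rintro ⟨b, hb, h⟩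
  rwa [hsub i _ hb (hH (x t) i)] at h

end NetworkGame

theorem mainTheorem10 {N n : ℕ} (g : NetworkGame N n) (hreg : g.IsRegular)
    (Q : Fin N → Matrix (Fin n) (Fin n) ℝ) (hQ : ∀ i, (Q i).PosDef)
    (f : Fin N → EuclideanSpace ℝ (Fin n) → EuclideanSpace ℝ (Fin n))
    (hcost : ∀ i y z, g.cost i y z = 1 / 2 * weightedNormSq (Q i) y + inner ℝ (f i z) y)
    (hmono : StronglyMonotoneOn g.gameJacobian g.profiles) :
    ∃ xstar : Profile N n, g.IsNash xstar ∧ (∀ y, g.IsNash y → y = xstar) ∧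
      ∀ x₀ ∈ g.profiles,
        (∃ x : ℝ → Profile N n, g.IsBRTrajectory x₀ x) ∧
        (∀ x y : ℝ → Profile N n, g.IsBRTrajectory x₀ x → g.IsBRTrajectory x₀ y →
          Set.EqOn x y (Set.Ici 0)) ∧
        (∀ x : ℝ → Profile N n, g.IsBRTrajectory x₀ x →
          Filter.Tendsto x Filter.atTop (𝓝 xstar)) := by
  obtain ⟨α, hα, hmono⟩ := hmono
  obtain ⟨L, hF⟩ := hreg.exists_lipschitzOnWith_gameJacobian
  have hcl := g.isClosed_profiles hreg.isClosed
  have hconv := g.convex_profiles hreg.convex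
  have hsub := NetworkGame.bestResponse_subsingleton_of_quadratic hreg.convex hQ hcost
  choose B hB using NetworkGame.bestResponse_nonempty_of_quadratic hreg hQ hcost
  obtain ⟨H, hH⟩ : ∃ H : Profile N n → Profile N n,
      ∀ x i, H x i ∈ g.bestResponse i (g.aggregate i x) :=
    ⟨fun x => WithLp.toLp 2 fun i => B i (g.aggregate i x), fun x i => hB i _⟩
  have hproj := NetworkGame.isForwardProjection_of_mem_bestResponse hreg.convex hQ hcost hH
  obtain ⟨c, hc, hA⟩ := (blockDiagonalCLM Q).exists_pos_mul_norm_sq_le_inner fun v hv =>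
    inner_blockDiagonalCLM_pos hQ hv
  have hA0 : ∀ v, 0 ≤ inner ℝ (blockDiagonalCLM Q v) v := fun v => le_trans (by positivity) (hA v)
  obtain ⟨M, hM⟩ := hproj.exists_lipschitzOnWith hc hA hF
  have hconverge : ∀ x : ℝ → Profile N n, (∀ t, 0 ≤ t → x t ∈ g.profiles) →
      IsIntegralCurveOn x (fun _ z => H z - z) (Set.Ici 0) →
      ∃ p ∈ g.profiles, H p = p ∧ Filter.Tendsto x Filter.atTop (𝓝 p) := fun x hxK hx =>
    hproj.exists_tendsto_fixedPoint hcl (inner_blockDiagonalCLM fun i => (hQ i).isHermitian)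
      hc hA hF hα hmono hxK hx
  have hfix : ∀ x, g.IsNash x → H x = x := fun x hx => PiLp.ext fun i => hsub i _ (hH x i) (hx i)
  have huniq : ∀ p ∈ g.profiles, ∀ q ∈ g.profiles, H p = p → H q = q → p = q := by
    intro p hp q hq hHp hHq
    have h := hproj.norm_sub_le hA0 hF hα hmono hp hq
    rw [hHp, hHq, sub_self, sub_self, sub_self, norm_zero, mul_zero] at h
    exact sub_eq_zero.1 (norm_le_zero_iff.1 h)
  -- The equilibrium is obtained as the limit of an arbitrary trajectory, so neither compactness nor
  -- a topological fixed-point theorem is needed.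
  obtain ⟨a, ha⟩ := g.nonempty_profiles hreg.nonempty
  obtain ⟨xa, -, hxaK, hxa⟩ :=
    hM.exists_isIntegralCurveOn_sub hcl hconv hproj.mapsTo ha
  obtain ⟨p, hpK, hp, -⟩ := hconverge xa hxaK hxa
  refine ⟨p, fun i => ?_, fun y hy => ?_, fun x₀ h0 => ⟨?_, fun x y hx hy => ?_, fun x hx => ?_⟩⟩
  · have := hH p i
    rwa [hp] at this
  · exact huniq y (fun i => (hy i).1) p hpK (hfix y hy) hp
  · obtain ⟨x, hx0, -, hx⟩ := hM.exists_isIntegralCurveOn_sub hcl hconv hproj.mapsTo h0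
    exact ⟨x, (NetworkGame.isBRTrajectory_iff hH hsub).2 ⟨hx0, hx⟩⟩
  · have hx' := (NetworkGame.isBRTrajectory_iff hH hsub).1 hx
    have hy' := (NetworkGame.isBRTrajectory_iff hH hsub).1 hy
    exact hM.eqOn_of_isIntegralCurveOn_sub (hx'.1.trans hy'.1.symm)
      (fun t => hx.mem_profiles hreg.isClosed hreg.convex h0)
      (fun t => hy.mem_profiles hreg.isClosed hreg.convex h0) hx'.2 hy'.2
  · obtain ⟨q, hqK, hq, hlim⟩ := hconverge x
      (fun t => hx.mem_profiles hreg.isClosed hreg.convex h0)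
      ((NetworkGame.isBRTrajectory_iff hH hsub).1 hx).2
    rwa [huniq q hqK p hpK hq hp] at hlim
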